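/- Let $G$ be a finite undirected connected loopless multigraph with vertices $v_0,\dots,v_n$ and $m$ edges, let $b_{ij}$ be the number of edges joining $v_i$ and $v_j$, and let $g=m-(n+1)+1$. A divisor is a vector $D\in\mathbb{Z}^{n+1}$; its degree is $\deg D=\sum_i D_i$, and it is effective if all $D_i\ge 0$. A move of the chip-firing game lets one vertex lend, or borrow, one chip along each edge incident with it; two divisors are equivalent if one is reached from the other by finitely many moves. The rank $r(D)$ is one less than the minimum of $\deg E$ over effective divisors $E$ such that $D-E$ is not equivalent to an effective divisor. Let $L_G\subset\mathbb{Z}^{n+1}$ be the lattice generated by the rows of the Laplacian matrix of $G$, let $H_0=\{x\in\mathbb{R}^{n+1}:\sum_i x_i=0\}$, and let $\pi_0$ be the orthogonal projection of $\mathbb{R}^{n+1}$ onto $H_0$. Let $\triangle\subset H_0$ be the convex hull of $t_0,\dots,t_n$, where $t_i$ has $i$-th coordinate $n$ and all other coordinates $-1$. For $a,b\ge 0$ and $p\in H_0$ let $\mathcal{P}_{a,b}(p)=p+a\triangle+b(-\triangle)$ (Minkowski sum). For a permutation $\pi$ of the vertices, orient every edge from its smaller to its larger end in the order $\pi(v_0)<_\pi\pi(v_1)<_\pi\dots<_\pi\pi(v_n)$,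 let $\nu_\pi=(\mathrm{indeg}_\pi(v_0)-1,\dots,\mathrm{indeg}_\pi(v_n)-1)$, and put $c_\pi=\pi_0(\nu_\pi)$. Theorem. Let $D$ be a divisor of degree $d$ with $0\le d\le g-1$. For a permutation $\pi$ and an integer $r\ge 0$ let $T(\pi,r)$ be the condition $$\pi_0(D)\in\bigcup_{q\in L_G}\mathcal{P}_{\frac{r}{n+1},\,\frac{r+g-1-d}{n+1}}(c_\pi+q).$$ Consider the following algorithm, which calls an arbitrary decision procedure for the conditions $T(\pi,r)$. For each of the $(n+1)!$ permutations $\pi$, run a binary search on $r$: start with $lo=0$, $hi=g$; while $lo<hi$, let $mid=\lfloor (lo+hi)/2\rfloor$, and set $hi:=mid$ if $T(\pi,mid)$ holds and $lo:=mid+1$ otherwise; let $r_\pi$ be the final value of $lo$. Output $\min_\pi r_\pi-1$. Then the output is $r(D)$. -/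

import Mathlib

open scoped Pointwise

/-- A finite undirected loopless multigraph on the vertices `v_0, …, v_n`, given by the number
`mult i j` of edges joining `v_i` and `v_j`. -/
structure Multigraph (n : ℕ) where
  mult : Fin (n + 1) → Fin (n + 1) → ℕ
  symm : ∀ i j, mult i j = mult j i
  loopless : ∀ i, mult i i = 0

/-- Divisors: integer vectors with `n + 1` coordinates. -/
abbrev Divisor (n : ℕ) := Fin (n + 1) → ℤ

/-- The degree of a divisor is its total number of chips. -/
def Divisor.deg {n : ℕ} (D : Divisor n) : ℤ := ∑ i, D i

/-- The Euclidean space `ℝ^{n+1}`. -/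
abbrev Pt (n : ℕ) := EuclideanSpace ℝ (Fin (n + 1))

/-- An integer vector seen as a point of `ℝ^{n+1}`. -/
def Divisor.toPt {n : ℕ} (D : Divisor n) : Pt n := WithLp.toLp 2 (fun i => (D i : ℝ))

namespace Multigraph

variable {n : ℕ} (G : Multigraph n)

/-- The underlying simple graph. -/
def toSimpleGraph : SimpleGraph (Fin (n + 1)) where
  Adj i j := 0 < G.mult i j
  symm := ⟨fun i j h => by rw [G.symm j i]; exact h⟩
  loopless := ⟨fun i h => by simp [G.loopless i] at h⟩

/-- `G` is connected. -/
def Connected : Prop := G.toSimpleGraph.Connected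

/-- The degree of a vertex, counting edges with multiplicity. -/
def vertexDeg (v : Fin (n + 1)) : ℕ := ∑ u, G.mult v u

/-- The number of edges. -/
def numEdges : ℕ := ∑ i, ∑ j, if i < j then G.mult i j else 0

/-- The cyclotomic number: number of edges minus number of vertices plus one. -/
def genus : ℤ := (G.numEdges : ℤ) - ((n : ℤ) + 1) + 1

/-! ### Chip firing, equivalence and rank -/

/-- The vertex `v` lends one chip along each edge incident with it. -/
def lend (v : Fin (n + 1)) (D : Divisor n) : Divisor n :=
  fun u => if u = v then D u - G.vertexDeg v else D u + G.mult v u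

/-- The vertex `v` borrows one chip along each edge incident with it. -/
def borrow (v : Fin (n + 1)) (D : Divisor n) : Divisor n :=
  fun u => if u = v then D u + G.vertexDeg v else D u - G.mult v u

/-- One move of the chip-firing game. -/
def Move (D D' : Divisor n) : Prop := ∃ v, D' = G.lend v D ∨ D' = G.borrow v D

/-- `D'` can be reached from `D` by a sequence of chip firings. -/
def Equivalent (D D' : Divisor n) : Prop := Relation.ReflTransGen G.Move D D'

/-- `D` is equivalent to an effective divisor. -/
def Winnable (D : Divisor n) : Prop := ∃ E : Divisor n, 0 ≤ E ∧ G.Equivalent D E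

/-- The numbers `k` such that `k` chips can be removed from `D` so that the result is not
equivalent to an effective divisor. -/
def unwinnableRemovals (D : Divisor n) : Set ℕ :=
  {k | ∃ E : Divisor n, 0 ≤ E ∧ E.deg = k ∧ ¬ G.Winnable (D - E)}

/-- The rank of a divisor: one less than the minimum number of chips that must be removed from it
so that the result is not equivalent to an effective divisor. (This set of numbers is nonempty,
see `unwinnableRemovals_nonempty`, so the infimum is a minimum.) -/
noncomputable def rank (D : Divisor n) : ℤ := (sInf (G.unwinnableRemovals D) : ℕ) - 1

theorem deg_lend (v : Fin (n + 1)) (D : Divisor n) : (G.lend v D).deg = D.deg := by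
  have h : ∀ u, G.lend v D u
      = D u + (G.mult v u : ℤ) - (if u = v then (G.vertexDeg v : ℤ) else 0) := by
    intro u
    unfold lend
    split_ifs with huv
    · subst huv; simp [G.loopless]
    · simp
  simp [Divisor.deg, h, Finset.sum_add_distrib, vertexDeg]

theorem deg_borrow (v : Fin (n + 1)) (D : Divisor n) : (G.borrow v D).deg = D.deg := by
  have h : ∀ u, G.borrow v D u
      = D u - (G.mult v u : ℤ) + (if u = v then (G.vertexDeg v : ℤ) else 0) := by
    intro u
    unfold borrow
    split_ifs with huv
    · subst huv; simp [G.loopless]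
    · simp
  simp [Divisor.deg, h, Finset.sum_add_distrib, vertexDeg]

theorem Equivalent.deg_eq {D D' : Divisor n} (h : G.Equivalent D D') : D'.deg = D.deg := by
  induction h with
  | refl => rfl
  | tail _ hm ih =>
    obtain ⟨v, rfl | rfl⟩ := hm
    · rw [deg_lend, ih]
    · rw [deg_borrow, ih]

theorem unwinnableRemovals_nonempty (D : Divisor n) : (G.unwinnableRemovals D).Nonempty := by
  refine ⟨(D.deg + 1).toNat, Pi.single 0 ((D.deg + 1).toNat : ℤ), ?_, ?_, ?_⟩
  · exact Pi.single_nonneg.2 (by positivity)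
  · simp [Divisor.deg]
  · rintro ⟨F, hF, hE⟩
    have h1 := Equivalent.deg_eq G hE
    have h2 : 0 ≤ F.deg := Finset.sum_nonneg fun i _ => hF i
    have h3 : (D - Pi.single 0 ((D.deg + 1).toNat : ℤ)).deg
        = D.deg - ((D.deg + 1).toNat : ℤ) := by
      simp [Divisor.deg, Finset.sum_sub_distrib]
    have h4 := Int.self_le_toNat (D.deg + 1)
    omega

/-! ### The Laplacian lattice and the points `c_π` -/

/-- The Laplacian matrix. -/
def laplacian : Matrix (Fin (n + 1)) (Fin (n + 1)) ℤ :=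
  Matrix.of fun i j => if i = j then (G.vertexDeg i : ℤ) else -(G.mult i j : ℤ)

/-- The Laplacian lattice, generated by the rows of the Laplacian matrix. -/
def laplacianLattice : AddSubgroup (Divisor n) :=
  AddSubgroup.closure (Set.range fun i => G.laplacian i)

/-- The indegree of `v` when all edges are oriented along
`π(v_0) <_π π(v_1) <_π ⋯ <_π π(v_n)`. -/
def indeg (π : Equiv.Perm (Fin (n + 1))) (v : Fin (n + 1)) : ℕ :=
  ∑ u, if π.symm u < π.symm v then G.mult u v else 0

/-- The divisor `ν_π`. -/
def nu (π : Equiv.Perm (Fin (n + 1))) : Divisor n := fun v => (G.indeg π v : ℤ) - 1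

end Multigraph

/-! ### The simplices and polytopes in `H_0` -/

/-- The hyperplane `H_0` of points with coordinate sum zero. -/
def hyperplaneZero (n : ℕ) : Submodule ℝ (Pt n) where
  carrier := {x | ∑ i, x i = 0}
  zero_mem' := by simp
  add_mem' := by
    intro a b ha hb
    simp only [Set.mem_ofPred_eq] at ha hb ⊢
    simp [Finset.sum_add_distrib, ha, hb]
  smul_mem' := by
    intro c a ha
    simp only [Set.mem_ofPred_eq] at ha ⊢
    simp [← Finset.mul_sum, ha]

/-- The orthogonal projection `π_0` onto `H_0`. -/
noncomputable def projZero {n : ℕ} (x : Pt n) : Pt n := (hyperplaneZero n).starProjection x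

/-- The vertex `t_i` of the regular simplex: coordinate `n` at `i`, and `-1` elsewhere. -/
noncomputable def simplexVertex (n : ℕ) (i : Fin (n + 1)) : Pt n :=
  WithLp.toLp 2 (fun j => if i = j then (n : ℝ) else -1)

/-- The regular simplex `△`. -/
noncomputable def regularSimplex (n : ℕ) : Set (Pt n) :=
  convexHull ℝ (Set.range (simplexVertex n))

/-- The polytope `P_{a,b}(p)`: the Minkowski sum of `a • △` and `b • (-△)`, translated by `p`. -/
noncomputable def minkPolytope {n : ℕ} (a b : ℝ) (p : Pt n) : Set (Pt n) :=
  p +ᵥ (a • regularSimplex n + b • (-regularSimplex n))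

/-! ### The algorithm -/

/-- Binary search on `lo, …, hi`. The value `hi` itself is never tested; it is the answer when
every test fails. -/
def binarySearch (p : ℕ → Prop) (test : ∀ r, Decidable (p r)) (lo hi : ℕ) : ℕ :=
  if lo < hi then
    match test ((lo + hi) / 2) with
    | .isTrue _ => binarySearch p test lo ((lo + hi) / 2)
    | .isFalse _ => binarySearch p test ((lo + hi) / 2 + 1) hi
  else lo
termination_by hi - lo

namespace Multigraph

variable {n : ℕ} (G : Multigraph n)

/-- The point `c_π = π_0(ν_π)` of `H_0`. -/
noncomputable def critPoint (π : Equiv.Perm (Fin (n + 1))) : Pt n := projZero (G.nu π).toPt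

/-- The condition tested for the permutation `π` and the parameter `r`: the point `π_0(D)` lies in
the union, over all `q` in the Laplacian lattice, of the polytopes
`P_{r/(n+1), (r+g-1-d)/(n+1)}(c_π + q)`, where `d` is the degree of `D`. -/
def InArrangement (D : Divisor n) (π : Equiv.Perm (Fin (n + 1))) (r : ℕ) : Prop :=
  projZero D.toPt ∈ ⋃ q ∈ G.laplacianLattice,
    minkPolytope ((r : ℝ) / ((n : ℝ) + 1))
      (((r : ℝ) + (G.genus : ℝ) - 1 - (D.deg : ℝ)) / ((n : ℝ) + 1))
      (G.critPoint π + Divisor.toPt q)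

/-- The algorithm: for every permutation `π` a binary search on `0, …, g` for the least `r` that
passes the membership test; the output is the minimum over all `π`, minus one. The membership
tests are made by the decision procedure `test`. -/
def rankAlgorithm (D : Divisor n) (test : ∀ π r, Decidable (G.InArrangement D π r)) : ℤ :=
  ((Finset.univ.inf' ⟨1, Finset.mem_univ _⟩ fun π : Equiv.Perm (Fin (n + 1)) =>
    binarySearch (G.InArrangement D π) (test π) 0 G.genus.toNat : ℕ) : ℤ) - 1

end Multigraph

/-! A divisor is unwinnable exactly when some translate of it by `L_G` lies below some `ν_π`. For
one direction, pass to a reduced divisor, which is still in debt at the base vertex; the order in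
which Dhar's fire burns the vertices gives `π`. For the other, a maximum argument shows that no
`ν_π` dominates a Laplacian image (`Connected.not_winnable_iff`).

Hence `r(D) + 1` is the minimum of `deg (D - q - ν_π)⁺` over `π` and `q`, since the positive part is
the cheapest effective divisor to remove to get below `q + ν_π`.

For fixed `π` the polytopes measure the same quantity. Since `t_i` is `n + 1` times the projection
of the `i`-th basis vector, `T(π, r)` says that `D - q - ν_π = w - z` with real `w, z ≥ 0` of sums
`r` and `r + g - 1 - d`; projecting loses nothing because the degrees agree. Such a splitting exists
iff `deg (D - q - ν_π)⁺ ≤ r` (`inArrangement_iff`). So `T(π, r)` is monotone in `r` and binary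
search is valid. The cap at `g` does not affect the minimum, because `r(D) + 1 ≤ d + 1 ≤ g`. -/

namespace Multigraph

/-! ### The Laplacian operator -/

section Laplacian

variable {n : ℕ} (G : Multigraph n)

/-- The Laplacian of `G` as an operator on integer functions on the vertices. -/
def lap (f : Fin (n + 1) → ℤ) : Divisor n := fun v => ∑ u, (G.mult v u : ℤ) * (f v - f u)

theorem lap_add (f g : Fin (n + 1) → ℤ) : G.lap (f + g) = G.lap f + G.lap g := by
  funext v
  simp only [lap, Pi.add_apply, ← Finset.sum_add_distrib]
  exact Finset.sum_congr rfl fun u _ => by ring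

theorem lap_neg (f : Fin (n + 1) → ℤ) : G.lap (-f) = -G.lap f := by
  funext v
  simp only [lap, Pi.neg_apply, ← Finset.sum_neg_distrib]
  exact Finset.sum_congr rfl fun u _ => by ring

theorem lap_smul (c : ℤ) (f : Fin (n + 1) → ℤ) : G.lap (c • f) = c • G.lap f := by
  funext v
  simp only [lap, Pi.smul_apply, smul_eq_mul, Finset.mul_sum]
  exact Finset.sum_congr rfl fun u _ => by ring

theorem lap_sub (f g : Fin (n + 1) → ℤ) : G.lap (f - g) = G.lap f - G.lap g := by
  rw [sub_eq_add_neg, lap_add, lap_neg, sub_eq_add_neg]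

theorem lap_zero : G.lap 0 = 0 := by
  funext v
  simp [lap]

theorem laplacian_apply (i j : Fin (n + 1)) :
    G.laplacian i j = (if i = j then (G.vertexDeg i : ℤ) else 0) - G.mult i j := by
  simp only [laplacian, Matrix.of_apply]
  split_ifs with h
  · subst h; simp [G.loopless]
  · ring

theorem laplacian_mulVec (f : Fin (n + 1) → ℤ) : G.laplacian.mulVec f = G.lap f := by
  funext v
  simp only [Matrix.mulVec, dotProduct, laplacian_apply, lap, vertexDeg]
  simp [sub_mul, mul_sub, Finset.sum_sub_distrib, Finset.sum_mul]

theorem lap_single (v : Fin (n + 1)) : G.lap (Pi.single v 1) = G.laplacian v := by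
  rw [← laplacian_mulVec]
  funext u
  rw [Matrix.mulVec_single_one, Matrix.col_apply, laplacian_apply, laplacian_apply, G.symm u v]
  by_cases h : u = v
  · subst h; rfl
  · rw [if_neg h, if_neg (Ne.symm h)]

theorem lap_mem_laplacianLattice (f : Fin (n + 1) → ℤ) : G.lap f ∈ G.laplacianLattice := by
  have h : G.lap f = ∑ v, f v • G.laplacian v := by
    rw [← laplacian_mulVec]
    funext u
    simp only [Matrix.mulVec, dotProduct, Finset.sum_apply, Pi.smul_apply, smul_eq_mul]
    refine Finset.sum_congr rfl fun v _ => ?_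
    rw [laplacian_apply, laplacian_apply, G.symm u v, mul_comm]
    by_cases h : u = v
    · subst h; rfl
    · rw [if_neg h, if_neg (Ne.symm h)]
  rw [h]
  exact sum_mem fun v _ => zsmul_mem (AddSubgroup.subset_closure (Set.mem_range_self v)) _

theorem exists_lap_eq {q : Divisor n} (hq : q ∈ G.laplacianLattice) : ∃ f, G.lap f = q := by
  induction hq using AddSubgroup.closure_induction with
  | mem x hx =>
    obtain ⟨v, rfl⟩ := hx
    exact ⟨_, G.lap_single v⟩
  | zero => exact ⟨0, G.lap_zero⟩
  | add x y _ _ hx hy =>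
    obtain ⟨f, rfl⟩ := hx
    obtain ⟨g, rfl⟩ := hy
    exact ⟨f + g, G.lap_add f g⟩
  | neg x _ hx =>
    obtain ⟨f, rfl⟩ := hx
    exact ⟨-f, G.lap_neg f⟩

theorem lend_eq (v : Fin (n + 1)) (D : Divisor n) : G.lend v D = D - G.laplacian v := by
  funext u
  rw [Pi.sub_apply, laplacian_apply]
  unfold lend
  by_cases h : u = v
  · subst h; simp [G.loopless]
  · simp [h, Ne.symm h]

theorem borrow_eq (v : Fin (n + 1)) (D : Divisor n) : G.borrow v D = D + G.laplacian v := by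
  funext u
  rw [Pi.add_apply, laplacian_apply]
  unfold borrow
  by_cases h : u = v
  · subst h; simp [G.loopless]
  · simp [h, Ne.symm h]; ring

/-- Subtracting a generator of the lattice is a lending move and subtracting its negative a
borrowing move, so a lattice element is a sequence of moves. -/
theorem equivalent_sub_of_mem {q : Divisor n} (hq : q ∈ G.laplacianLattice) (D : Divisor n) :
    G.Equivalent D (D - q) := by
  induction hq using AddSubgroup.closure_induction'' generalizing D with
  | mem x hx =>
    obtain ⟨v, rfl⟩ := hx
    exact Relation.ReflTransGen.single ⟨v, Or.inl (G.lend_eq v D).symm⟩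
  | neg_mem x hx =>
    obtain ⟨v, rfl⟩ := hx
    refine Relation.ReflTransGen.single ⟨v, Or.inr ?_⟩
    rw [borrow_eq, sub_neg_eq_add]
  | zero => rw [sub_zero]; exact Relation.ReflTransGen.refl
  | add x y _ _ hx hy =>
    rw [← sub_sub]
    exact (hx D).trans (hy (D - x))

theorem Equivalent.sub_mem {D D' : Divisor n} (h : G.Equivalent D D') :
    D - D' ∈ G.laplacianLattice := by
  induction h with
  | refl => rw [sub_self]; exact zero_mem _
  | @tail B C _ hm ih =>
    obtain ⟨v, rfl | rfl⟩ := hm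
    · rw [lend_eq, ← sub_add]
      exact add_mem ih (AddSubgroup.subset_closure (Set.mem_range_self v))
    · rw [borrow_eq, ← sub_sub]
      exact _root_.sub_mem ih (AddSubgroup.subset_closure (Set.mem_range_self v))

theorem winnable_iff (D : Divisor n) : G.Winnable D ↔ ∃ f, G.lap f ≤ D := by
  constructor
  · rintro ⟨E, hE, h⟩
    obtain ⟨f, hf⟩ := G.exists_lap_eq (Equivalent.sub_mem G h)
    exact ⟨f, hf.le.trans (sub_le_self _ hE)⟩
  · rintro ⟨f, hf⟩
    exact ⟨D - G.lap f, sub_nonneg.2 hf, G.equivalent_sub_of_mem (G.lap_mem_laplacianLattice f) D⟩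

end Laplacian

/-! ### The maximum principle and reduced divisors -/

section Reduced

variable {n : ℕ} {G : Multigraph n}

/-- At a maximum every term of the Laplacian is nonnegative, so a strictly smaller neighbour would
make the sum positive. -/
theorem eq_max_of_lap_nonpos {f : Fin (n + 1) → ℤ} {M : ℤ} (hM : ∀ v, f v ≤ M)
    {v u : Fin (n + 1)} (hv : f v = M) (hlap : G.lap f v ≤ 0) (hu : 0 < G.mult v u) : f u = M := by
  by_contra hne
  have hlt : f u < M := lt_of_le_of_ne (hM u) hne
  have : 0 < G.lap f v := by
    refine Finset.sum_pos' (fun w _ => ?_) ⟨u, Finset.mem_univ _, ?_⟩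
    · exact mul_nonneg (Int.natCast_nonneg _) (by linarith [hM w])
    · exact mul_pos (by exact_mod_cast hu) (by linarith)
  omega

/-- The maximum principle: a function that is subharmonic off `v₀` is maximal at `v₀`. -/
theorem Connected.le_of_lap_nonpos (hG : G.Connected) {v₀ : Fin (n + 1)} {f : Fin (n + 1) → ℤ}
    (hf : ∀ v, v ≠ v₀ → G.lap f v ≤ 0) (v : Fin (n + 1)) : f v ≤ f v₀ := by
  obtain ⟨w, hw⟩ := Finite.exists_max f
  obtain ⟨p⟩ := SimpleGraph.Connected.preconnected hG w v₀
  have key : ∀ {a b : Fin (n + 1)}, G.toSimpleGraph.Walk a b → b = v₀ → f a = f w → f b = f w := by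
    intro a b p hb ha
    induction p with
    | nil => exact ha
    | @cons a c b hac p ih =>
      by_cases h : a = v₀
      · rw [hb, ← h, ha]
      · exact ih hb (eq_max_of_lap_nonpos hw ha (hf a h) hac)
  rw [key p rfl rfl]
  exact hw v

/-- There is an integer function vanishing at `v₀` whose Laplacian is at least one elsewhere. -/
theorem Connected.exists_one_le_lap (hG : G.Connected) (v₀ : Fin (n + 1)) :
    ∃ h : Fin (n + 1) → ℤ, h v₀ = 0 ∧ ∀ v, v ≠ v₀ → 1 ≤ G.lap h v := by
  -- The row at `v₀` now reads off `f v₀`, so a kernel vector is harmonic off `v₀` and zero at `v₀`;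
  -- the maximum principle for `±f` makes it vanish.
  set A := G.laplacian.updateRow v₀ (Pi.single v₀ 1) with hA
  have hA₀ : ∀ f, A.mulVec f v₀ = f v₀ := fun f => by
    simp [hA, Matrix.mulVec, dotProduct, Pi.single_apply]
  have hA₁ : ∀ f v, v ≠ v₀ → A.mulVec f v = G.lap f v := fun f v hv => by
    rw [← laplacian_mulVec]
    simp [hA, Matrix.mulVec, Matrix.updateRow_ne hv]
  have hdet : A.det ≠ 0 := by
    intro h0
    obtain ⟨f, hne, hf⟩ := Matrix.exists_mulVec_eq_zero_iff.2 h0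
    have hf₀ : f v₀ = 0 := by rw [← hA₀ f, hf]; rfl
    have hf₁ : ∀ v, v ≠ v₀ → G.lap f v = 0 := fun v hv => by rw [← hA₁ f v hv, hf]; rfl
    apply hne
    funext v
    have h1 := hG.le_of_lap_nonpos (fun v hv => (hf₁ v hv).le) v
    have h2 := hG.le_of_lap_nonpos (f := -f) (v₀ := v₀)
      (fun v hv => by rw [lap_neg, Pi.neg_apply, hf₁ v hv, neg_zero]) v
    simp only [Pi.neg_apply, Pi.zero_apply] at h2 ⊢
    omega
  -- The adjugate keeps the solution integral; with this right-hand side its Laplacian off `v₀` is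
  -- `det A ^ 2 ≥ 1`.
  set b : Fin (n + 1) → ℤ := fun v => if v = v₀ then 0 else A.det with hb
  have hmul : A.mulVec (A.adjugate.mulVec b) = A.det • b := by
    rw [Matrix.mulVec_mulVec, Matrix.mul_adjugate, Matrix.smul_mulVec, Matrix.one_mulVec]
  refine ⟨A.adjugate.mulVec b, ?_, fun v hv => ?_⟩
  · rw [← hA₀ (A.adjugate.mulVec b), hmul]; simp [hb]
  · rw [← hA₁ _ v hv, hmul]
    simp only [hb, Pi.smul_apply, smul_eq_mul, if_neg hv]
    have := mul_self_pos.2 hdet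
    omega

theorem lap_indicator_of_mem {S : Finset (Fin (n + 1))} {v : Fin (n + 1)} (hv : v ∈ S) :
    G.lap (fun u => if u ∈ S then 1 else 0) v = ∑ u, if u ∈ S then 0 else (G.mult v u : ℤ) := by
  refine Finset.sum_congr rfl fun u _ => ?_
  by_cases hu : u ∈ S <;> simp [hu, hv]

theorem lap_indicator_of_notMem {S : Finset (Fin (n + 1))} {v : Fin (n + 1)} (hv : v ∉ S) :
    G.lap (fun u => if u ∈ S then 1 else 0) v ≤ 0 := by
  refine Finset.sum_nonpos fun u _ => ?_
  by_cases hu : u ∈ S <;> simp [hu, hv]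

/-- Every divisor is equivalent to a `v₀`-reduced one. -/
theorem Connected.exists_reduced (hG : G.Connected) (v₀ : Fin (n + 1)) (D : Divisor n) :
    ∃ f : Fin (n + 1) → ℤ, (∀ v, v ≠ v₀ → 0 ≤ D v - G.lap f v) ∧
      ∀ S : Finset (Fin (n + 1)), S.Nonempty → v₀ ∉ S →
        ∃ v ∈ S, D v - G.lap f v < ∑ u, if u ∈ S then 0 else (G.mult v u : ℤ) := by
  obtain ⟨h, h₀, h₁⟩ := hG.exists_one_le_lap v₀
  obtain ⟨N, hN⟩ : ∃ N : ℤ, ∀ v, |D v| ≤ N := by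
    obtain ⟨w, hw⟩ := Finite.exists_max fun v => |D v|
    exact ⟨_, hw⟩
  have hN0 : 0 ≤ N := (abs_nonneg _).trans (hN v₀)
  have hNh : ∀ v, v ≠ v₀ → N ≤ N * G.lap h v := fun v hv => by nlinarith [h₁ v hv]
  -- A script of maximal sum among those that fix `v₀` and leave no debt elsewhere is reduced: a set
  -- that could still fire would increase the sum.
  let P : ℤ → Prop := fun s => ∃ f : Fin (n + 1) → ℤ,
    f v₀ = 0 ∧ (∀ v, v ≠ v₀ → 0 ≤ D v - G.lap f v) ∧ ∑ v, f v = s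
  have hne : ∃ s, P s := by
    refine ⟨_, -(N • h), by simp [h₀], fun v hv => ?_, rfl⟩
    rw [lap_neg, lap_smul]
    simp only [Pi.neg_apply, Pi.smul_apply, smul_eq_mul]
    linarith [neg_abs_le (D v), hN v, hNh v hv]
  have hbdd : ∃ b, ∀ s, P s → s ≤ b := by
    refine ⟨∑ v, N * h v, ?_⟩
    rintro s ⟨f, hf₀, hf₁, rfl⟩
    refine Finset.sum_le_sum fun v _ => ?_
    -- Off `v₀`, `lap f ≤ D ≤ N ≤ N * lap h`, so the maximum principle bounds `f` by `N * h`.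
    have := hG.le_of_lap_nonpos (f := f - N • h) (v₀ := v₀) (fun v hv => by
      rw [lap_sub, lap_smul]
      simp only [Pi.sub_apply, Pi.smul_apply, smul_eq_mul]
      linarith [le_abs_self (D v), hN v, hNh v hv, hf₁ v hv]) v
    simp only [Pi.sub_apply, Pi.smul_apply, smul_eq_mul, h₀, hf₀] at this
    linarith
  obtain ⟨s, ⟨f, hf₀, hf₁, rfl⟩, hmax⟩ := Int.exists_greatest_of_bdd hbdd hne
  refine ⟨f, hf₁, fun S hS hv₀ => ?_⟩
  by_contra! hcon
  have hP := hmax _ ⟨f + fun u => if u ∈ S then 1 else 0, by simp [hf₀, hv₀], fun v hv => ?_, rfl⟩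
  · have : (0 : ℤ) < ∑ u, if u ∈ S then 1 else 0 := by
      rw [Finset.sum_ite_mem]
      simpa using hS
    simp only [Pi.add_apply, Finset.sum_add_distrib] at hP
    linarith
  · rw [lap_add, Pi.add_apply]
    by_cases hvS : v ∈ S
    · rw [lap_indicator_of_mem hvS]
      linarith [hcon v hvS]
    · linarith [lap_indicator_of_notMem (G := G) hvS, hf₁ v hv]

end Reduced

/-! ### Unwinnable divisors -/

section Unwinnable

variable {n : ℕ} {G : Multigraph n}

/-- Dhar's burning procedure. -/
theorem exists_burning_order {D : Divisor n}
    (hD : ∀ S : Finset (Fin (n + 1)), S.Nonempty →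
      ∃ v ∈ S, D v < ∑ u, if u ∈ S then 0 else (G.mult v u : ℤ))
    (S : Finset (Fin (n + 1))) :
    ∃ σ : Fin (n + 1) → ℕ, Set.InjOn σ S ∧
      ∀ v ∈ S, D v < ∑ u, if u ∈ S ∧ σ v ≤ σ u then 0 else (G.mult v u : ℤ) := by
  induction S using Finset.strongInduction with
  | H S ih =>
    rcases S.eq_empty_or_nonempty with rfl | hS
    · exact ⟨0, by simp, by simp⟩
    obtain ⟨w, hw, hDw⟩ := hD S hS
    obtain ⟨σ, hinj, hσ⟩ := ih _ (Finset.erase_ssubset hw)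
    -- `w` burns first, and the order on the remaining vertices is shifted by one. Vertices outside
    -- `S` count as already burnt.
    refine ⟨fun v => if v = w then 0 else σ v + 1, ?_, fun v hv => ?_⟩
    · intro a ha b hb hab
      by_cases h1 : a = w <;> by_cases h2 : b = w <;> simp [h1, h2] at hab ⊢
      exact hinj (by simpa [h1] using ha) (by simpa [h2] using hb) hab
    · by_cases hvw : v = w
      · subst hvw
        simpa using hDw
      · refine (hσ v (Finset.mem_erase.2 ⟨hvw, hv⟩)).trans_le (le_of_eq ?_)
        refine Finset.sum_congr rfl fun u _ => ?_
        by_cases huw : u = w <;> simp [huw, hvw]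

theorem exists_perm_lt_iff {σ : Fin (n + 1) → ℕ} (hσ : Function.Injective σ) :
    ∃ π : Equiv.Perm (Fin (n + 1)), ∀ u v, π.symm u < π.symm v ↔ σ u < σ v := by
  refine ⟨Tuple.sort σ, fun u v => ?_⟩
  have h : StrictMono (σ ∘ Tuple.sort σ) :=
    (Tuple.monotone_sort σ).strictMono_of_injective (hσ.comp (Tuple.sort σ).injective)
  rw [← h.lt_iff_lt]
  simp

/-- The divisors `ν_π` are not winnable. -/
theorem not_lap_le_nu (π : Equiv.Perm (Fin (n + 1))) (f : Fin (n + 1) → ℤ) :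
    ¬ G.lap f ≤ G.nu π := by
  intro hf
  obtain ⟨w, hw⟩ := Finite.exists_max f
  -- Take the `π`-first maximizer of `f`: all its `π`-predecessors have strictly smaller values, so
  -- each incoming edge adds at least one to `lap f v`.
  obtain ⟨v, hv, hmin⟩ := Finset.exists_min_image (Finset.univ.filter fun v => f v = f w) π.symm
    ⟨w, by simp⟩
  simp only [Finset.mem_filter, Finset.mem_univ, true_and] at hv hmin
  have h1 : (G.indeg π v : ℤ) ≤ G.lap f v := by
    rw [indeg, Nat.cast_sum]
    refine Finset.sum_le_sum fun u _ => ?_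
    have hle := hw u
    split_ifs with h
    · have hlt : f u < f v := by
        rw [hv]
        refine lt_of_le_of_ne hle fun he => ?_
        exact absurd (hmin u he) (not_le.2 h)
      rw [G.symm u v]
      exact le_mul_of_one_le_right (Int.natCast_nonneg _) (by omega)
    · exact mul_nonneg (Int.natCast_nonneg _) (by omega)
  have h2 := hf v
  simp only [nu] at h2
  omega

/-- A divisor is not winnable if and only if it is equivalent to a divisor below some `ν_π`. -/
theorem Connected.not_winnable_iff (hG : G.Connected) (D : Divisor n) :
    ¬ G.Winnable D ↔ ∃ π, ∃ q ∈ G.laplacianLattice, D - q ≤ G.nu π := by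
  rw [winnable_iff]
  constructor
  · intro hD
    obtain ⟨f, hf, hred⟩ := hG.exists_reduced 0 D
    have h0 : D 0 - G.lap f 0 < 0 := by
      by_contra! h0
      refine hD ⟨f, fun v => ?_⟩
      by_cases hv : v = 0
      · subst hv; linarith
      · linarith [hf v hv]
    -- Sets containing the base vertex burn there because of its debt; for the others reducedness
    -- applies.
    obtain ⟨σ, hinj, hσ⟩ := exists_burning_order (G := G) (D := D - G.lap f) (fun S hS => by
      by_cases h : (0 : Fin (n + 1)) ∈ S
      · refine ⟨0, h, h0.trans_le (Finset.sum_nonneg fun u _ => ?_)⟩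
        split_ifs <;> simp
      · exact hred S hS h) Finset.univ
    obtain ⟨π, hπ⟩ := exists_perm_lt_iff (σ := σ) (by simpa using hinj)
    refine ⟨π, G.lap f, G.lap_mem_laplacianLattice f, fun v => ?_⟩
    have h := hσ v (Finset.mem_univ v)
    have h2 : (G.indeg π v : ℤ) =
        ∑ u, if u ∈ Finset.univ ∧ σ v ≤ σ u then 0 else (G.mult v u : ℤ) := by
      rw [indeg, Nat.cast_sum]
      refine Finset.sum_congr rfl fun u _ => ?_
      rw [G.symm u v]
      by_cases hlt : σ u < σ v
      · simp [hπ, hlt]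
      · simp [hπ, hlt, not_lt.1 hlt]
    rw [← h2] at h
    exact Int.le_sub_one_of_lt h
  · rintro ⟨π, q, hq, hle⟩ ⟨f, hf⟩
    obtain ⟨g, rfl⟩ := G.exists_lap_eq hq
    refine not_lap_le_nu (G := G) π (f - g) ?_
    rw [lap_sub]
    exact (sub_le_sub_right hf _).trans hle

/-- Adding the count for the reversed order counts each edge in both directions, so twice the sum
does not depend on the order; compare with the identity. -/
theorem sum_indeg (π : Equiv.Perm (Fin (n + 1))) : ∑ v, G.indeg π v = G.numEdges := by
  have key : ∀ τ : Equiv.Perm (Fin (n + 1)),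
      2 * ∑ v, ∑ u, (if τ u < τ v then G.mult u v else 0) = ∑ v, ∑ u, G.mult u v := by
    intro τ
    rw [two_mul]
    nth_rewrite 2 [Finset.sum_comm]
    simp only [← Finset.sum_add_distrib]
    refine Finset.sum_congr rfl fun v _ => Finset.sum_congr rfl fun u _ => ?_
    rcases lt_trichotomy (τ u) (τ v) with h | h | h
    · simp [h, h.not_gt]
    · rw [τ.injective h]; simp [G.loopless]
    · simp [h, h.not_gt, G.symm v u]
  have h1 := key π.symm
  have h2 := key 1
  change 2 * ∑ v, ∑ u, (if u < v then G.mult u v else 0) = _ at h2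
  rw [numEdges, Finset.sum_comm]
  simp only [indeg]
  omega

theorem deg_nu (π : Equiv.Perm (Fin (n + 1))) : (G.nu π).deg = G.genus - 1 := by
  simp only [Divisor.deg, nu, Finset.sum_sub_distrib, genus, ← sum_indeg (G := G) π]
  push_cast
  simp

end Unwinnable

end Multigraph

/-! ### The polytopes in coordinates -/

section Polytopes

variable {n : ℕ}

theorem projZero_apply (x : Pt n) (i : Fin (n + 1)) :
    projZero x i = x i - (∑ j, x j) / ((n : ℝ) + 1) := by
  have hn : (n : ℝ) + 1 ≠ 0 := by positivity
  have h : projZero x = WithLp.toLp 2 fun i => x i - (∑ j, x j) / ((n : ℝ) + 1) := by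
    refine Submodule.eq_starProjection_of_mem_of_inner_eq_zero ?_ fun w hw => ?_
    · change ∑ i, (x i - (∑ j, x j) / ((n : ℝ) + 1)) = 0
      simp only [Finset.sum_sub_distrib, Finset.sum_const, Finset.card_univ, Fintype.card_fin,
        nsmul_eq_mul]
      push_cast
      field_simp
      ring
    · have hw' : ∑ i, w i = 0 := hw
      simp [PiLp.inner_apply, ← Finset.sum_mul, hw']
  rw [h]

/-- This factor `n + 1` is what the denominators in `T(π, r)` cancel. -/
theorem sum_smul_simplexVertex (w : Fin (n + 1) → ℝ) :
    ∑ i, w i • simplexVertex n i = ((n : ℝ) + 1) • projZero (WithLp.toLp 2 w) := by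
  have hn : (n : ℝ) + 1 ≠ 0 := by positivity
  ext j
  rw [PiLp.smul_apply, projZero_apply]
  have h : ∀ i, (w i • simplexVertex n i) j = (if i = j then ((n : ℝ) + 1) * w i else 0) - w i := by
    intro i
    simp only [simplexVertex, PiLp.smul_apply, smul_eq_mul]
    split_ifs <;> ring
  rw [WithLp.ofLp_sum, Finset.sum_apply, Finset.sum_congr rfl fun i _ => h i]
  simp only [Finset.sum_sub_distrib, Finset.sum_ite_eq', Finset.mem_univ, if_true, smul_eq_mul]
  field_simp

theorem mem_regularSimplex_iff {y : Pt n} :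
    y ∈ regularSimplex n ↔ ∃ w : Fin (n + 1) → ℝ, (∀ i, 0 ≤ w i) ∧ ∑ i, w i = 1 ∧
      y = ((n : ℝ) + 1) • projZero (WithLp.toLp 2 w) := by
  have h : regularSimplex n =
      Fintype.linearCombination ℝ (simplexVertex n) '' stdSimplex ℝ (Fin (n + 1)) := by
    rw [← convexHull_rangle_single_eq_stdSimplex, LinearMap.image_convexHull, ← Set.range_comp]
    refine congrArg (fun f => convexHull ℝ (Set.range f)) (funext fun i => ?_)
    simp
  rw [h]
  simp only [Set.mem_image, Fintype.linearCombination_apply, sum_smul_simplexVertex, stdSimplex,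
    Set.mem_ofPred_eq, and_assoc, @eq_comm _ y]

theorem projZero_smul (c : ℝ) (x : Pt n) : projZero (c • x) = c • projZero x :=
  map_smul (hyperplaneZero n).starProjection c x

theorem mem_smul_regularSimplex_iff {a : ℝ} (ha : 0 ≤ a) {y : Pt n} :
    y ∈ (a / ((n : ℝ) + 1)) • regularSimplex n ↔ ∃ w : Fin (n + 1) → ℝ, (∀ i, 0 ≤ w i) ∧
      ∑ i, w i = a ∧ y = projZero (WithLp.toLp 2 w) := by
  have hn : (n : ℝ) + 1 ≠ 0 := by positivity
  have hsmul : ∀ w : Fin (n + 1) → ℝ,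
      (a / ((n : ℝ) + 1)) • ((n : ℝ) + 1) • projZero (WithLp.toLp 2 w)
        = projZero (WithLp.toLp 2 (a • w)) := fun w => by
    rw [smul_smul, div_mul_cancel₀ _ hn, ← projZero_smul, WithLp.toLp_smul]
  rw [Set.mem_smul_set]
  constructor
  · rintro ⟨x, hx, rfl⟩
    obtain ⟨w, hw, hw1, rfl⟩ := mem_regularSimplex_iff.1 hx
    refine ⟨a • w, fun i => mul_nonneg ha (hw i), ?_, hsmul w⟩
    simp [← Finset.mul_sum, hw1]
  · rintro ⟨w, hw, hwa, rfl⟩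
    obtain ⟨u, hu, hu1, huw⟩ : ∃ u : Fin (n + 1) → ℝ, (∀ i, 0 ≤ u i) ∧ ∑ i, u i = 1 ∧ a • u = w := by
      -- For `a = 0` all weights vanish and any point of the simplex serves.
      rcases ha.eq_or_lt with rfl | hpos
      · refine ⟨Pi.single 0 1, fun i => ?_, by simp, ?_⟩
        · exact (Pi.single_nonneg.2 zero_le_one : (0 : Fin (n + 1) → ℝ) ≤ Pi.single 0 1) i
        · funext i
          simpa using ((Finset.sum_eq_zero_iff_of_nonneg fun i _ => hw i).1 hwa i
            (Finset.mem_univ i)).symm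
      · refine ⟨a⁻¹ • w, fun i => mul_nonneg (inv_nonneg.2 ha) (hw i), ?_,
          smul_inv_smul₀ hpos.ne' w⟩
        simp [← Finset.mul_sum, hwa, hpos.ne']
    exact ⟨_, mem_regularSimplex_iff.2 ⟨u, hu, hu1, rfl⟩, by rw [hsmul, huw]⟩

theorem mem_minkPolytope_iff {a b : ℝ} (ha : 0 ≤ a) (hb : 0 ≤ b) {p y : Pt n} :
    y ∈ minkPolytope (a / ((n : ℝ) + 1)) (b / ((n : ℝ) + 1)) p ↔
      ∃ w z : Fin (n + 1) → ℝ, (∀ i, 0 ≤ w i) ∧ (∀ i, 0 ≤ z i) ∧ ∑ i, w i = a ∧ ∑ i, z i = b ∧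
        y = p + (projZero (WithLp.toLp 2 w) - projZero (WithLp.toLp 2 z)) := by
  rw [minkPolytope, Set.mem_vadd_set]
  simp only [Set.mem_add, vadd_eq_add, Set.smul_set_neg, Set.mem_neg]
  constructor
  · rintro ⟨_, ⟨x, hx, x', hx', rfl⟩, rfl⟩
    rw [mem_smul_regularSimplex_iff ha] at hx
    rw [mem_smul_regularSimplex_iff hb] at hx'
    obtain ⟨w, hw, hwa, rfl⟩ := hx
    obtain ⟨z, hz, hzb, hx'⟩ := hx'
    exact ⟨w, z, hw, hz, hwa, hzb, by rw [← hx', sub_neg_eq_add]⟩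
  · rintro ⟨w, z, hw, hz, hwa, hzb, rfl⟩
    refine ⟨_, ⟨_, (mem_smul_regularSimplex_iff ha).2 ⟨w, hw, hwa, rfl⟩, _, ?_,
      (sub_eq_add_neg _ _).symm⟩, rfl⟩
    rw [neg_neg]
    exact (mem_smul_regularSimplex_iff hb).2 ⟨z, hz, hzb, rfl⟩

end Polytopes

/-! ### The membership test and the rank -/

namespace Multigraph

section Rank

variable {n : ℕ} {G : Multigraph n}

theorem deg_eq_zero_of_mem {q : Divisor n} (hq : q ∈ G.laplacianLattice) : q.deg = 0 := by
  have h := Equivalent.deg_eq G (G.equivalent_sub_of_mem hq 0)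
  simpa [Divisor.deg] using h

/-- In a splitting `w - z` with `w, z ≥ 0`, `w` dominates the positive part; conversely the positive
and negative parts, padded equally, have the required sums. This also makes real weights equivalent
to an integral condition. -/
theorem inArrangement_iff {D : Divisor n} (hDg : D.deg ≤ G.genus - 1)
    (π : Equiv.Perm (Fin (n + 1))) (r : ℕ) :
    G.InArrangement D π r ↔ ∃ q ∈ G.laplacianLattice, Divisor.deg (D - q - G.nu π)⁺ ≤ r := by
  have hn : (n : ℝ) + 1 ≠ 0 := by positivity
  have hb : (0 : ℝ) ≤ (r : ℝ) + G.genus - 1 - D.deg := by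
    have h1 : (D.deg : ℝ) ≤ (G.genus : ℝ) - 1 := by exact_mod_cast hDg
    have h2 : (0 : ℝ) ≤ r := r.cast_nonneg
    linarith
  simp only [InArrangement, Set.mem_iUnion, exists_prop,
    mem_minkPolytope_iff r.cast_nonneg hb]
  refine exists_congr fun q => and_congr_right fun hq => ?_
  have hq0 : ∑ i, (q i : ℝ) = 0 := by exact_mod_cast deg_eq_zero_of_mem hq
  have hD : ∑ i, (D i : ℝ) = D.deg := by simp [Divisor.deg]
  have hν : ∑ i, (G.nu π i : ℝ) = G.genus - 1 := by
    exact_mod_cast deg_nu (G := G) π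
  constructor
  · rintro ⟨w, z, hw, hz, hwr, hzr, h⟩
    -- Both sides subtract the same average, as `d = (g - 1) + r - (r + g - 1 - d)` and `deg q = 0`,
    -- so the projection can be removed.
    have hx : ∀ i, (D i : ℝ) - q i - G.nu π i = w i - z i := fun i => by
      have hi := congrArg (fun y : Pt n => y i) h
      simp only [critPoint, PiLp.add_apply, PiLp.sub_apply, projZero_apply, Divisor.toPt,
        hD, hν, hwr, hzr] at hi
      field_simp at hi
      have h0 : ((n : ℝ) + 1) * ((D i : ℝ) - q i - G.nu π i - (w i - z i)) = 0 := by linarith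
      have := (mul_eq_zero.1 h0).resolve_left hn
      linarith
    have hle : ∀ i, (((D - q - G.nu π)⁺ i : ℤ) : ℝ) ≤ w i := fun i => by
      rw [Pi.posPart_apply, posPart_def]
      push_cast [Pi.sub_apply]
      exact sup_le (by linarith [hx i, hz i]) (hw i)
    have : ((Divisor.deg (D - q - G.nu π)⁺ : ℤ) : ℝ) ≤ (r : ℤ) := by
      rw [Divisor.deg, Int.cast_sum, Int.cast_natCast, ← hwr]
      exact Finset.sum_le_sum fun i _ => hle i
    exact_mod_cast this
  · intro hr
    set x := D - q - G.nu π with hx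
    have hk : ∑ i, ((x⁺ i : ℤ) : ℝ) = (Divisor.deg x⁺ : ℤ) := by simp [Divisor.deg]
    have hxi : ∀ i, ((x⁺ i : ℤ) : ℝ) - ((x⁻ i : ℤ) : ℝ) = D i - q i - G.nu π i := fun i => by
      have := congrFun (posPart_sub_negPart x) i
      rw [hx] at this ⊢
      simp only [Pi.sub_apply] at this
      exact_mod_cast this
    have hk' : ∑ i, ((x⁻ i : ℤ) : ℝ) = (Divisor.deg x⁺ : ℤ) + G.genus - 1 - D.deg := by
      have := Finset.sum_congr (rfl : (Finset.univ : Finset (Fin (n + 1))) = _) fun i _ => hxi i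
      simp only [Finset.sum_sub_distrib, hk, hD, hν, hq0] at this
      linarith
    have hc : (0 : ℝ) ≤ r - (Divisor.deg x⁺ : ℤ) := by
      rw [sub_nonneg]; exact_mod_cast hr
    -- The slack `r - deg x⁺` is put at vertex `0` in both `w` and `z`, where it cancels.
    have hc' : ∀ i, 0 ≤ (Pi.single 0 (r - (Divisor.deg x⁺ : ℤ) : ℝ) : Fin (n + 1) → ℝ) i :=
      fun i => (Pi.single_nonneg.2 hc : (0 : Fin (n + 1) → ℝ) ≤ _) i
    have hpos : ∀ i, (0 : ℝ) ≤ (x⁺ i : ℤ) := fun i => by exact_mod_cast posPart_nonneg x i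
    have hneg : ∀ i, (0 : ℝ) ≤ (x⁻ i : ℤ) := fun i => by exact_mod_cast negPart_nonneg x i
    have hw : ∑ i, (((x⁺ i : ℤ) : ℝ) +
        (Pi.single 0 (r - (Divisor.deg x⁺ : ℤ) : ℝ) : Fin (n + 1) → ℝ) i) = r := by
      rw [Finset.sum_add_distrib, hk]; simp
    have hz : ∑ i, (((x⁻ i : ℤ) : ℝ) +
        (Pi.single 0 (r - (Divisor.deg x⁺ : ℤ) : ℝ) : Fin (n + 1) → ℝ) i)
          = r + G.genus - 1 - D.deg := by
      rw [Finset.sum_add_distrib, hk']; simp; ring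
    refine ⟨_, _, fun i => add_nonneg (hpos i) (hc' i), fun i => add_nonneg (hneg i) (hc' i),
      hw, hz, ?_⟩
    ext i
    simp only [critPoint, PiLp.add_apply, PiLp.sub_apply, projZero_apply, Divisor.toPt,
      hD, hν, hw, hz]
    have := hxi i
    field_simp
    linear_combination (-(n : ℝ) - 1) * this

theorem InArrangement.mono {D : Divisor n} (hDg : D.deg ≤ G.genus - 1)
    {π : Equiv.Perm (Fin (n + 1))} {r s : ℕ} (hrs : r ≤ s) (h : G.InArrangement D π r) :
    G.InArrangement D π s := by
  rw [inArrangement_iff hDg] at h ⊢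
  obtain ⟨q, hq, hle⟩ := h
  exact ⟨q, hq, hle.trans (by exact_mod_cast hrs)⟩

theorem Connected.exists_inArrangement (hG : G.Connected) {D : Divisor n}
    (hDg : D.deg ≤ G.genus - 1) {k : ℕ} (hk : k ∈ G.unwinnableRemovals D) :
    ∃ π, G.InArrangement D π k := by
  obtain ⟨E, hE, hEk, hDE⟩ := hk
  obtain ⟨π, q, hq, hle⟩ := (hG.not_winnable_iff _).1 hDE
  refine ⟨π, (inArrangement_iff hDg π k).2 ⟨q, hq, ?_⟩⟩
  rw [← hEk]
  refine Finset.sum_le_sum fun i _ => ?_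
  have h1 := hle i
  have h2 := hE i
  simp only [Pi.sub_apply, Pi.zero_apply] at h1 h2
  rw [Pi.posPart_apply, posPart_def]
  simp only [Pi.sub_apply]
  exact sup_le (by linarith) h2

theorem Connected.sInf_unwinnableRemovals_le (hG : G.Connected) {D : Divisor n}
    (hDg : D.deg ≤ G.genus - 1) {π : Equiv.Perm (Fin (n + 1))} {r : ℕ}
    (h : G.InArrangement D π r) : sInf (G.unwinnableRemovals D) ≤ r := by
  obtain ⟨q, hq, hle⟩ := (inArrangement_iff hDg π r).1 h
  set x := D - q - G.nu π with hx
  have hnonneg : 0 ≤ Divisor.deg x⁺ := Finset.sum_nonneg fun i _ => posPart_nonneg x i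
  have hmem : (Divisor.deg x⁺).toNat ∈ G.unwinnableRemovals D := by
    refine ⟨x⁺, posPart_nonneg x, (Int.toNat_of_nonneg hnonneg).symm, ?_⟩
    refine (hG.not_winnable_iff _).2 ⟨π, q, hq, ?_⟩
    rw [sub_right_comm, sub_le_iff_le_add', ← sub_le_iff_le_add]
    exact le_posPart x
  exact (Nat.sInf_le hmem).trans (by omega)

/-- Removing `d + 1` chips (for `d ≥ 0`) leaves negative degree, which moves preserve. -/
theorem sInf_unwinnableRemovals_le_deg_add_one (D : Divisor n) :
    sInf (G.unwinnableRemovals D) ≤ (D.deg + 1).toNat := by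
  refine Nat.sInf_le ⟨Pi.single 0 ((D.deg + 1).toNat : ℤ), ?_, ?_, ?_⟩
  · exact Pi.single_nonneg.2 (by positivity)
  · simp [Divisor.deg]
  · rintro ⟨F, hF, hE⟩
    have h1 := Equivalent.deg_eq G hE
    have h2 : 0 ≤ F.deg := Finset.sum_nonneg fun i _ => hF i
    have h3 : (D - Pi.single 0 ((D.deg + 1).toNat : ℤ)).deg
        = D.deg - ((D.deg + 1).toNat : ℤ) := by
      simp [Divisor.deg, Finset.sum_sub_distrib]
    have h4 := Int.self_le_toNat (D.deg + 1)
    omega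

end Rank

end Multigraph

/-- Binary search for a monotone predicate returns the least solution in `lo, …, hi - 1`, or `hi`
if there is none. -/
theorem binarySearch_spec {p : ℕ → Prop} (hp : ∀ r s, r ≤ s → p r → p s)
    (test : ∀ r, Decidable (p r)) {lo hi : ℕ} (h : lo ≤ hi) :
    lo ≤ binarySearch p test lo hi ∧ binarySearch p test lo hi ≤ hi ∧
      ∀ k, lo ≤ k → k < hi → (p k ↔ binarySearch p test lo hi ≤ k) := by
  induction hd : hi - lo using Nat.strong_induction_on generalizing lo hi with
  | _ d ih =>
    rw [binarySearch]
    split_ifs with hlt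
    · cases test ((lo + hi) / 2) with
      | isTrue ht =>
        obtain ⟨h1, h2, h3⟩ := ih ((lo + hi) / 2 - lo) (by omega) (hi := (lo + hi) / 2)
          (lo := lo) (by omega) rfl
        refine ⟨h1, h2.trans (by omega), fun k hk hk' => ?_⟩
        by_cases hkm : k < (lo + hi) / 2
        · exact h3 k hk hkm
        · exact iff_of_true (hp _ _ (by omega) ht) (h2.trans (by omega))
      | isFalse ht =>
        obtain ⟨h1, h2, h3⟩ := ih (hi - ((lo + hi) / 2 + 1)) (by omega) (hi := hi)
          (lo := (lo + hi) / 2 + 1) (by omega) rfl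
        refine ⟨le_trans (by omega) h1, h2, fun k hk hk' => ?_⟩
        by_cases hkm : (lo + hi) / 2 + 1 ≤ k
        · exact h3 k hkm hk'
        · exact iff_of_false (fun hpk => ht (hp _ _ (by omega) hpk)) (by dsimp only; omega)
    · exact ⟨le_rfl, h, fun k hk hk' => by omega⟩

theorem mainTheorem2 {n : ℕ} (G : Multigraph n) (hG : G.Connected) (D : Divisor n)
    (hD0 : 0 ≤ D.deg) (hDg : D.deg ≤ G.genus - 1)
    (test : ∀ (π : Equiv.Perm (Fin (n + 1))) (r : ℕ), Decidable (G.InArrangement D π r)) :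
    G.rankAlgorithm D test = G.rank D := by
  have hspec := fun π => binarySearch_spec
    (fun r s hrs => Multigraph.InArrangement.mono hDg (π := π) hrs) (test π)
    (Nat.zero_le G.genus.toNat)
  set R := sInf (G.unwinnableRemovals D) with hR
  have hRg : R ≤ G.genus.toNat :=
    (Multigraph.sInf_unwinnableRemovals_le_deg_add_one D).trans (by omega)
  -- A search value below `g` passes its test, hence is at least `R`; the untested value `g` is
  -- covered by `R ≤ g`.
  have hlow : ∀ π, R ≤ binarySearch (G.InArrangement D π) (test π) 0 G.genus.toNat := by
    intro π
    obtain ⟨-, h2, h3⟩ := hspec π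
    rcases h2.eq_or_lt with h | h
    · rw [h]; exact hRg
    · exact hG.sInf_unwinnableRemovals_le hDg ((h3 _ (Nat.zero_le _) h).2 le_rfl)
  obtain ⟨π, hπ⟩ := hG.exists_inArrangement hDg
    (Nat.sInf_mem (G.unwinnableRemovals_nonempty D))
  -- The minimum removal `R` passes the test for this `π`; if `R = g`, the range of the search
  -- already gives the bound.
  have hup : binarySearch (G.InArrangement D π) (test π) 0 G.genus.toNat ≤ R := by
    obtain ⟨-, h2, h3⟩ := hspec π
    rcases hRg.eq_or_lt with h | h
    · rw [h]; exact h2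
    · exact (h3 R (Nat.zero_le _) h).1 hπ
  rw [Multigraph.rankAlgorithm, Multigraph.rank, ← hR]
  congr 2
  exact le_antisymm ((Finset.inf'_le _ (Finset.mem_univ π)).trans hup)
    (Finset.le_inf' _ _ fun σ _ => hlow σ)
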